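/- All groups are finite, and characters are complex characters. Let $\mathrm{Irr}(G)$ be the set of irreducible characters of a finite group $G$. For a positive multiple $n$ of $|G|$ let $\mathbb{Q}_n\subseteq\mathbb{C}$ be the $n$-th cyclotomic field; $\mathrm{Gal}(\mathbb{Q}_n|\mathbb{Q})$ acts on $\mathrm{Irr}(G)$ by $\chi^{\alpha}(g)=\chi(g)^{\alpha}$. Two characters $\chi,\psi\in\mathrm{Irr}(G)$ are called Galois conjugate if $\chi^{\alpha}=\psi$ for some such $n$ and some $\alpha\in\mathrm{Gal}(\mathbb{Q}_n|\mathbb{Q})$ (this does not depend on the choice of $n$). A finite group $G$ is called a $\mathbf{GC}^{*}$-group if any two non-linear (i.e. of degree $\chi(1)\neq 1$) irreducible characters of $G$ that have the same degree are Galois conjugate. Corollary. Let $G$ be a finite nilpotent $\mathbf{GC}^{*}$-group. Then either $G$ is abelian, or $G$ is a $p$-group for some prime $p$, the centre of $G$ is cyclic, and the commutator subgroup of $G$ has prime order. -/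

import Mathlib

/-- `χ` is an irreducible complex character of `G`: the trace of an irreducible complex
representation of `G` of finite dimension `d` (realised, without loss of generality, on `ℂ^d`). -/
def IsIrrChar {G : Type*} [Group G] (χ : G → ℂ) : Prop :=
  ∃ (d : ℕ) (ρ : Representation ℂ G (Fin d → ℂ)), ρ.IsIrreducible ∧ ρ.character = χ

/-- The `n`-th cyclotomic field `ℚ_n`, as the subfield of `ℂ` generated by the complex `n`-th
roots of unity (used for `n ≠ 0` only). -/
noncomputable def cyclotomicSubfield (n : ℕ) : IntermediateField ℚ ℂ :=
  IntermediateField.adjoin ℚ {z : ℂ | z ^ n = 1}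

/-- `χ` and `ψ` are Galois conjugate in `Gal(ℚ_n | ℚ)`: some automorphism `α` of `ℚ_n` satisfies
`χ(g)^α = ψ(g)` for all `g` (in particular the values of `χ` and `ψ` lie in `ℚ_n`). -/
def GaloisConjugateIn {G : Type*} (n : ℕ) (χ ψ : G → ℂ) : Prop :=
  ∃ α : cyclotomicSubfield n ≃ₐ[ℚ] cyclotomicSubfield n,
    ∀ g : G, ∃ x : cyclotomicSubfield n, (x : ℂ) = χ g ∧ (α x : ℂ) = ψ g

/-- `χ` and `ψ` are Galois conjugate: they are so in `Gal(ℚ_n | ℚ)` for some positive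
multiple `n` of `|G|`. -/
def GaloisConjugate {G : Type*} (χ ψ : G → ℂ) : Prop :=
  ∃ n : ℕ, 0 < n ∧ Nat.card G ∣ n ∧ GaloisConjugateIn n χ ψ

/-- `G` is a `GC*`-group: any two non-linear (that is, of degree `χ(1) ≠ 1`) irreducible
characters of `G` of the same degree are Galois conjugate. -/
def IsGCStar (G : Type*) [Group G] : Prop :=
  ∀ χ ψ : G → ℂ, IsIrrChar χ → IsIrrChar ψ → χ 1 ≠ 1 → ψ 1 ≠ 1 → χ 1 = ψ 1 →
    GaloisConjugate χ ψ

/-!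
Let `G` be a nonabelian nilpotent `GC*`-group. If `N` is normal in `G` and does not contain `G'`,
take a nonlinear irreducible character of `G / N`. Its twists by linear characters of `G` are Galois
conjugate to it, hence trivial on `N`, so `N ≤ G'`. Since every normal subgroup is comparable with
`G'`, the nilpotent group `G` is a `p`-group. If `|G'| = p`, then the nonlinear irreducible
characters are faithful, so the centre is cyclic and their degrees are the square root of
`|G : Z(G)|`.

To see that `|G'| = p`, suppose by induction that `|(G / M)'| = p` for a subgroup `M ≤ G'` of
order `p`, and let `p ^ n` be the nonlinear degree of `G / M`. The irreducible characters of `G`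
nontrivial on `M` have degrees `p ^ a` with `a < n`. Being Galois conjugate, at most
`φ(exp G) ≤ |Z(G / M)| * p * (p - 1)` of them share a degree, so their squared degrees sum to less
than `|Z(G / M)| * (p - 1) * p ^ (2 * n) = (p - 1) * |G / M|`. But they sum to exactly this number.
-/

open Matrix
open scoped Finset commutatorElement

section Commutators

variable {G : Type*} [Group G]

theorem commutatorElement_mem_commutator (a b : G) : ⁅a, b⁆ ∈ commutator G :=
  Subgroup.commutator_mem_commutator (Subgroup.mem_top a) (Subgroup.mem_top b)

theorem commutator_le_ker_iff_forall_commute {M : Type*} [Monoid M] (f : G →* M) :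
    commutator G ≤ f.ker ↔ ∀ a b, Commute (f a) (f b) := by
  refine ⟨fun h a b ↦ ?_, fun h ↦ ?_⟩
  · have hab : a * b = ⁅a, b⁆ * (b * a) := by simp [commutatorElement_def]
    rw [commute_iff_eq, ← map_mul, hab, map_mul,
      MonoidHom.mem_ker.1 (h (commutatorElement_mem_commutator a b)), one_mul, map_mul]
  · rw [commutator_def, Subgroup.commutator_le]
    intro a _ b _
    calc f ⁅a, b⁆ = f a * f b * f (a⁻¹ * b⁻¹) := by
          rw [commutatorElement_def, mul_assoc (a * b), map_mul, map_mul f a]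
      _ = f (b * a * (a⁻¹ * b⁻¹)) := by rw [(h a b).eq, ← map_mul, ← map_mul]
      _ = 1 := by rw [mul_assoc b, mul_inv_cancel_left, mul_inv_cancel, map_one]

theorem commutator_eq_bot_iff_forall_mul_comm : commutator G = ⊥ ↔ ∀ a b : G, a * b = b * a := by
  rw [eq_bot_iff, ← MonoidHom.ker_id, commutator_le_ker_iff_forall_commute]
  rfl

theorem commutator_quotient_eq_bot_iff {N : Subgroup G} [N.Normal] :
    commutator (G ⧸ N) = ⊥ ↔ commutator G ≤ N := by
  have hmap : commutator (G ⧸ N) = (commutator G).map (QuotientGroup.mk' N) := by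
    rw [commutator_def, commutator_def, Subgroup.map_commutator,
      Subgroup.map_top_of_surjective _ (QuotientGroup.mk'_surjective N)]
  rw [hmap, Subgroup.map_eq_bot_iff, QuotientGroup.ker_mk']

theorem normal_of_le_center {N : Subgroup G} (hN : N ≤ Subgroup.center G) : N.Normal :=
  ⟨fun n hn g ↦ by rwa [Subgroup.mem_center_iff.1 (hN hn) g, mul_inv_cancel_right]⟩

theorem le_center_of_card_prime [Group.IsNilpotent G] {N : Subgroup G} [N.Normal]
    (hN : (Nat.card N).Prime) : N ≤ Subgroup.center G := by
  have : Finite N := Nat.finite_of_card_ne_zero hN.ne_zero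
  have hle : ⁅N, (⊤ : Subgroup G)⁆ ≤ N := Subgroup.commutator_le_left N ⊤
  have : Finite (⁅N, ⊤⁆ : Subgroup G) := Finite.Set.subset (N : Set G) hle
  obtain hone | hp := hN.eq_one_or_self_of_dvd _ (Subgroup.card_dvd_of_le hle)
  · rw [← Subgroup.commutator_top_right_eq_bot_iff_le_center]
    exact Subgroup.eq_bot_of_card_le _ hone.le
  · have hself : ⁅N, (⊤ : Subgroup G)⁆ = N := Subgroup.eq_of_le_of_card_ge hle hp.ge
    have hlower (n : ℕ) : N ≤ (⊤ : Subgroup G).lowerCentralSeries n := by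
      induction n with
      | zero => exact le_top
      | succ n ih => exact hself.ge.trans (Subgroup.commutator_mono ih le_rfl)
    obtain ⟨n, hn⟩ := Subgroup.nilpotent_iff_lowerCentralSeries.1 ‹Group.IsNilpotent G›
    exact (hlower n).trans (hn ▸ bot_le)

theorem pow_card_mem_center {M : Subgroup G} (hM : M ≤ Subgroup.center G) {x : G}
    (hx : ∀ y : G, ⁅y, x⁆ ∈ M) : x ^ Nat.card M ∈ Subgroup.center G := by
  refine Subgroup.mem_center_iff.2 fun y ↦ mul_inv_eq_iff_eq_mul.1 ?_
  have hpow : ⁅y, x⁆ ^ Nat.card M = 1 :=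
    congrArg Subtype.val (pow_card_eq_one' (x := (⟨_, hx y⟩ : M)))
  have hcomm : Commute ⁅y, x⁆ x := (Subgroup.mem_center_iff.1 (hM (hx y)) x).symm
  rw [← conj_pow, ← MulAut.conj_apply, conj_eq_commutatorElement_mul, hcomm.mul_pow, hpow, one_mul]

theorem exponent_dvd_mul_card {n : ℕ} {N : Subgroup G} (h : ∀ g : G, g ^ n ∈ N) :
    Monoid.exponent G ∣ n * Nat.card N := by
  refine Monoid.exponent_dvd_of_forall_pow_eq_one fun g ↦ ?_
  rw [pow_mul]
  exact congrArg Subtype.val (pow_card_eq_one' (x := (⟨_, h g⟩ : N)))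

end Commutators

section CentralQuotient

variable {G : Type*} [Group G] {M : Subgroup G} [M.Normal]

theorem card_map_mk'_mul_card {H : Subgroup G} (hMH : M ≤ H) :
    Nat.card (H.map (QuotientGroup.mk' M)) * Nat.card M = Nat.card H := by
  let f : H →* G ⧸ M := (QuotientGroup.mk' M).comp H.subtype
  have hker : f.ker = M.subgroupOf H := by
    rw [← MonoidHom.comap_ker, QuotientGroup.ker_mk', Subgroup.subgroupOf]
  have hrange : f.range = H.map (QuotientGroup.mk' M) := by
    rw [MonoidHom.range_comp, H.range_subtype]
  rw [← hrange, ← Subgroup.index_ker, hker,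
    ← Nat.card_congr (Subgroup.subgroupOfEquivOfLe hMH).toEquiv, mul_comm, Subgroup.card_mul_index]

theorem exponent_dvd_of_commutator_quotient_le_center
    (h : commutator (G ⧸ M) ≤ Subgroup.center (G ⧸ M)) :
    Monoid.exponent G ∣
      Nat.card (commutator (G ⧸ M)) * (Nat.card (Subgroup.center (G ⧸ M)) * Nat.card M) := by
  have hle : M ≤ (Subgroup.center (G ⧸ M)).comap (QuotientGroup.mk' M) := by
    conv_lhs => rw [← QuotientGroup.ker_mk' M]
    exact MonoidHom.ker_le_comap _ _
  rw [← Subgroup.map_comap_eq_self_of_surjective (QuotientGroup.mk'_surjective M)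
    (Subgroup.center (G ⧸ M)), card_map_mk'_mul_card hle]
  refine exponent_dvd_mul_card fun g ↦ Subgroup.mem_comap.2 ?_
  rw [map_pow]
  exact pow_card_mem_center h fun y ↦ commutatorElement_mem_commutator y _

theorem card_map_center_quotient_le [Finite G] (hM : M ≤ Subgroup.center G)
    [hcyc : IsCyclic (Subgroup.center (G ⧸ M))] :
    Nat.card ((Subgroup.center (G ⧸ M)).map
      (QuotientGroup.map M (Subgroup.center G) (MonoidHom.id G) hM)) ≤ Nat.card M := by
  obtain ⟨⟨q, hq⟩, hgen⟩ := hcyc.exists_generator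
  obtain ⟨x, rfl⟩ := QuotientGroup.mk'_surjective M q
  have hx (y : G) : ⁅y, x⁆ ∈ M := by
    rw [← QuotientGroup.eq_one_iff, ← QuotientGroup.mk'_apply, map_commutatorElement,
      commutatorElement_eq_one_iff_mul_comm]
    exact Subgroup.mem_center_iff.1 hq _
  have hpow : (x : G ⧸ Subgroup.center G) ^ Nat.card M = 1 :=
    (QuotientGroup.eq_one_iff _).2 (pow_card_mem_center hM hx)
  have hle : (Subgroup.center (G ⧸ M)).map
      (QuotientGroup.map M (Subgroup.center G) (MonoidHom.id G) hM) ≤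
        Subgroup.zpowers (x : G ⧸ Subgroup.center G) := by
    rintro _ ⟨w, hw, rfl⟩
    obtain ⟨k, hk⟩ := hgen ⟨w, hw⟩
    obtain rfl : QuotientGroup.mk' M x ^ k = w := congrArg Subtype.val hk
    exact ⟨k, by rw [map_zpow]; rfl⟩
  refine (Subgroup.card_le_of_le hle).trans ?_
  rw [Nat.card_zpowers]
  exact Nat.le_of_dvd Nat.card_pos (orderOf_dvd_of_pow_eq_one hpow)

theorem card_center_quotient_le [Finite G] (hM : M ≤ Subgroup.center G)
    [IsCyclic (Subgroup.center (G ⧸ M))] :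
    Nat.card (Subgroup.center (G ⧸ M)) ≤ Nat.card (Subgroup.center G) := by
  let f : Subgroup.center (G ⧸ M) →* G ⧸ Subgroup.center G :=
    (QuotientGroup.map M (Subgroup.center G) (MonoidHom.id G) hM).comp
      (Subgroup.center (G ⧸ M)).subtype
  have hrange : Nat.card f.range ≤ Nat.card M := by
    rw [MonoidHom.range_comp, Subgroup.range_subtype]
    exact card_map_center_quotient_le hM
  have hker : Nat.card f.ker * Nat.card M ≤ Nat.card (Subgroup.center G) := by
    have hle : f.ker.map (Subgroup.center (G ⧸ M)).subtype ≤
        (Subgroup.center G).map (QuotientGroup.mk' M) := by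
      rintro _ ⟨⟨q, hq⟩, hqf, rfl⟩
      obtain ⟨z, rfl⟩ := QuotientGroup.mk'_surjective M q
      exact ⟨z, (QuotientGroup.eq_one_iff z).1 hqf, rfl⟩
    rw [← card_map_mk'_mul_card hM,
      ← Subgroup.card_map_of_injective (Subgroup.center (G ⧸ M)).subtype_injective]
    exact Nat.mul_le_mul_right _ (Subgroup.card_le_of_le hle)
  calc Nat.card (Subgroup.center (G ⧸ M)) = Nat.card f.ker * Nat.card f.range := by
        rw [← f.ker.card_mul_index, Subgroup.index_ker]
    _ ≤ Nat.card f.ker * Nat.card M := Nat.mul_le_mul_left _ hrange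
    _ ≤ Nat.card (Subgroup.center G) := hker

theorem index_center_le [Finite G] (hM : M ≤ Subgroup.center G)
    [IsCyclic (Subgroup.center (G ⧸ M))] :
    (Subgroup.center G).index ≤ Nat.card M * (Subgroup.center (G ⧸ M)).index := by
  refine Nat.le_of_mul_le_mul_left ?_ (Nat.card_pos (α := Subgroup.center G))
  calc Nat.card (Subgroup.center G) * (Subgroup.center G).index
      = Nat.card (Subgroup.center (G ⧸ M)) * (Nat.card M * (Subgroup.center (G ⧸ M)).index) := by
        rw [Subgroup.card_mul_index, Subgroup.card_eq_card_quotient_mul_card_subgroup M,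
          ← (Subgroup.center (G ⧸ M)).card_mul_index, mul_assoc, mul_comm (Nat.card M)]
    _ ≤ Nat.card (Subgroup.center G) * (Nat.card M * (Subgroup.center (G ⧸ M)).index) :=
        Nat.mul_le_mul_right _ (card_center_quotient_le hM)

end CentralQuotient

section PGroups

variable {G : Type*} [Group G] [Finite G]

theorem exists_mem_center_orderOf_eq [Nontrivial G] {p : ℕ} [Fact p.Prime] (hG : IsPGroup p G) :
    ∃ x ∈ Subgroup.center G, orderOf x = p := by
  have := hG.center_nontrivial
  have hdvd : p ∣ Nat.card (Subgroup.center G) :=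
    (hG.to_subgroup (Subgroup.center G)).card_eq_or_dvd.resolve_left Finite.one_lt_card.ne'
  obtain ⟨x, hx⟩ := exists_prime_orderOf_dvd_card' p hdvd
  exact ⟨x, x.2, by rwa [Subgroup.orderOf_coe]⟩

theorem exists_isPGroup_of_forall_normal_comparable [Group.IsNilpotent G]
    (hG : commutator G ≠ ⊥)
    (h : ∀ N : Subgroup G, N.Normal → commutator G ≤ N ∨ N ≤ commutator G) :
    ∃ p : ℕ, p.Prime ∧ IsPGroup p G := by
  have : Nontrivial G := Subgroup.nontrivial_iff.1 ⟨_, _, hG⟩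
  have hindex : (commutator G).index ≠ 1 := fun h1 ↦
    (Group.IsSolvable.commutator_lt_top_of_nontrivial G).ne (Subgroup.index_eq_one.1 h1)
  obtain ⟨p, hp, hpdvd⟩ := Nat.exists_prime_and_dvd hindex
  have : Fact p.Prime := ⟨hp⟩
  obtain ⟨P⟩ : Nonempty (Sylow p G) := inferInstance
  have hP : commutator G ≤ P := (h P inferInstance).resolve_right fun hle ↦
    P.not_dvd_index (hpdvd.trans (Subgroup.index_dvd_of_le hle))
  refine ⟨p, hp, IsPGroup.of_card (Nat.eq_prime_pow_of_unique_prime_dvd Nat.card_pos.ne' ?_)⟩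
  intro q hq hqdvd
  by_contra hqp
  have : Fact q.Prime := ⟨hq⟩
  obtain ⟨Q⟩ : Nonempty (Sylow q G) := inferInstance
  have hdisj : Disjoint (P : Subgroup G) Q :=
    IsPGroup.disjoint_of_ne p q (Ne.symm hqp) _ _ P.isPGroup' Q.isPGroup'
  obtain hQ | hQ := h Q inferInstance
  · exact hG (disjoint_self.1 (hdisj.mono hP hQ))
  · have hQbot : (Q : Subgroup G) = ⊥ := disjoint_self.1 (hdisj.mono_left (hQ.trans hP))
    exact Q.ne_bot_of_dvd_card hqdvd hQbot

end PGroups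

section MatrixRepresentations

theorem finrank_le_index_of_span_range_eq_top {K G V : Type*} [Field K] [Group G] [AddCommGroup V]
    [Module K V] {f : G → V} (hf : Submodule.span K (Set.range f) = ⊤) {N : Subgroup G}
    [N.FiniteIndex] (hN : ∀ g, ∀ x ∈ N, f (g * x) ∈ Submodule.span K {f g}) :
    Module.finrank K V ≤ N.index := by
  have : Fintype (G ⧸ N) := Fintype.ofFinite (G ⧸ N)
  have hspan : Submodule.span K (Set.range fun q : G ⧸ N ↦ f q.out) = ⊤ := by
    rw [eq_top_iff, ← hf, Submodule.span_le]
    rintro _ ⟨g, rfl⟩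
    obtain ⟨x, hx⟩ := QuotientGroup.mk_out_eq_mul N g
    have hg : f g ∈ Submodule.span K {f (g : G ⧸ N).out} := by
      have hmem := hN (g : G ⧸ N).out _ (inv_mem x.2)
      have hout : (g : G ⧸ N).out * (x : G)⁻¹ = g := by rw [hx, mul_inv_cancel_right]
      rwa [hout] at hmem
    exact Submodule.span_mono (Set.singleton_subset_iff.2 (Set.mem_range_self (g : G ⧸ N))) hg
  rw [← finrank_top, ← hspan, Subgroup.index, Nat.card_eq_fintype_card]
  exact finrank_range_le_card _

variable {K G H n : Type*} [Field K] [Group G] [Group H] [Fintype n] [DecidableEq n]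

/-- The matrix representation `ρ` is absolutely irreducible. The definition is Burnside's criterion:
`n` is nonempty and the matrices `ρ g` span the full matrix algebra. Over an algebraically closed
field this is ordinary irreducibility. -/
structure IsAbsolutelyIrreducible (ρ : G →* Matrix n n K) : Prop where
  nonempty : Nonempty n
  span_range_eq_top : Submodule.span K (Set.range ρ) = ⊤

/-- The representation on column vectors given by a matrix representation. -/
def toRepresentation (ρ : G →* Matrix n n K) : Representation K G (n → K) :=
  (toLinAlgEquiv' : Matrix n n K ≃ₐ[K] _).toMonoidHom.comp ρ

theorem character_toRepresentation (ρ : G →* Matrix n n K) (g : G) :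
    (toRepresentation ρ).character g = (ρ g).trace :=
  Matrix.trace_toLin'_eq (ρ g)

/-- The product of a matrix representation with a linear character. -/
def linearTwist (ρ : G →* Matrix n n K) (χ : G →* Kˣ) : G →* Matrix n n K where
  toFun g := (χ g : K) • ρ g
  map_one' := by simp
  map_mul' a b := by simp [smul_smul, mul_comm]

theorem trace_map_conj (ρ : G →* Matrix n n K) (g h : G) :
    (ρ (h * g * h⁻¹)).trace = (ρ g).trace := by
  rw [map_mul, Matrix.trace_mul_comm, ← map_mul, inv_mul_cancel_left]

namespace IsAbsolutelyIrreducible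

variable {ρ : G →* Matrix n n K}

theorem comp_surjective {σ : H →* Matrix n n K} (hσ : IsAbsolutelyIrreducible σ) {f : G →* H}
    (hf : Function.Surjective f) : IsAbsolutelyIrreducible (σ.comp f) where
  nonempty := hσ.nonempty
  span_range_eq_top := by rw [MonoidHom.coe_comp, hf.range_comp, hσ.span_range_eq_top]

theorem mulVec_mem (hρ : IsAbsolutelyIrreducible ρ) (W : Subrepresentation (toRepresentation ρ))
    {v : n → K} (hv : v ∈ W.toSubmodule) (A : Matrix n n K) : A *ᵥ v ∈ W.toSubmodule := by
  have hA : A ∈ Submodule.span K (Set.range ρ) := hρ.span_range_eq_top ▸ Submodule.mem_top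
  induction hA using Submodule.span_induction with
  | mem x hx =>
    obtain ⟨g, rfl⟩ := hx
    exact W.apply_mem_toSubmodule g hv
  | zero => simp
  | add x y _ _ hx hy => rw [add_mulVec]; exact add_mem hx hy
  | smul a x _ hx => rw [smul_mulVec]; exact Submodule.smul_mem _ a hx

theorem isIrreducible_toRepresentation (hρ : IsAbsolutelyIrreducible ρ) :
    (toRepresentation ρ).IsIrreducible where
  exists_pair_ne :=
    have := hρ.nonempty
    ⟨⊥, ⊤, fun h ↦ bot_ne_top (congrArg Subrepresentation.toSubmodule h)⟩
  eq_bot_or_eq_top W := by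
    refine or_iff_not_imp_left.2 fun hW ↦
      Subrepresentation.toSubmodule_injective (eq_top_iff.2 fun w _ ↦ ?_)
    obtain ⟨v, hv, hv0⟩ := (Submodule.ne_bot_iff W.toSubmodule).1 fun h ↦
      hW (Subrepresentation.toSubmodule_injective h)
    obtain ⟨i, hi⟩ := Function.ne_iff.1 hv0
    have hw : vecMulVec w (Pi.single i (v i)⁻¹) *ᵥ v = w := by
      rw [vecMulVec_mulVec, single_dotProduct, inv_mul_cancel₀ hi, MulOpposite.op_one, one_smul]
    exact hw ▸ hρ.mulVec_mem W hv _

theorem exists_eq_smul_one_of_commute (hρ : IsAbsolutelyIrreducible ρ) {A : Matrix n n K}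
    (hA : ∀ g, Commute (ρ g) A) : ∃ c : K, A = c • 1 := by
  have hcomm (B : Matrix n n K) : Commute B A := by
    have hB : B ∈ Submodule.span K (Set.range ρ) := hρ.span_range_eq_top ▸ Submodule.mem_top
    induction hB using Submodule.span_induction with
    | mem x hx =>
      obtain ⟨g, rfl⟩ := hx
      exact hA g
    | zero => exact Commute.zero_left A
    | add x y _ _ hx hy => exact hx.add_left hy
    | smul a x _ hx => exact hx.smul_left a
  obtain ⟨c, hc⟩ := mem_range_scalar_of_commute_single (M := A) fun i j _ ↦ hcomm _
  exact ⟨c, by rw [← hc, scalar_apply, smul_one_eq_diagonal]⟩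

theorem exists_eq_smul_one_of_mem_center (hρ : IsAbsolutelyIrreducible ρ) {z : G}
    (hz : z ∈ Subgroup.center G) : ∃ c : K, ρ z = c • 1 :=
  hρ.exists_eq_smul_one_of_commute fun g ↦ by
    rw [commute_iff_eq, ← map_mul, ← map_mul, Subgroup.mem_center_iff.1 hz g]

theorem sq_card_le_index_of_forall_scalar (hρ : IsAbsolutelyIrreducible ρ) {N : Subgroup G}
    [N.FiniteIndex] (hN : ∀ x ∈ N, ∃ c : K, ρ x = c • 1) : Fintype.card n ^ 2 ≤ N.index := by
  have hle := finrank_le_index_of_span_range_eq_top hρ.span_range_eq_top (N := N) fun g x hx ↦ by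
    obtain ⟨c, hc⟩ := hN x hx
    exact Submodule.mem_span_singleton.2 ⟨c, by rw [map_mul, hc, mul_smul_one]⟩
  rwa [Module.finrank_matrix, Module.finrank_self, mul_one, ← sq] at hle

theorem sq_card_le_index_center [(Subgroup.center G).FiniteIndex]
    (hρ : IsAbsolutelyIrreducible ρ) : Fintype.card n ^ 2 ≤ (Subgroup.center G).index :=
  hρ.sq_card_le_index_of_forall_scalar fun _ ↦ hρ.exists_eq_smul_one_of_mem_center

theorem card_eq_one_iff (hρ : IsAbsolutelyIrreducible ρ) :
    Fintype.card n = 1 ↔ commutator G ≤ ρ.ker := by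
  rw [commutator_le_ker_iff_forall_commute]
  refine ⟨fun hn a b ↦ ?_, fun hcomm ↦ ?_⟩
  · have : Subsingleton n := Fintype.card_le_one_iff_subsingleton.1 hn.le
    ext i j
    rw [mul_apply, mul_apply]
    exact Finset.sum_congr rfl fun l _ ↦ by
      rw [Subsingleton.elim l i, Subsingleton.elim j i, mul_comm]
  · have hindex := hρ.sq_card_le_index_of_forall_scalar (N := ⊤) fun x _ ↦
      hρ.exists_eq_smul_one_of_commute fun g ↦ hcomm g x
    have := hρ.nonempty
    rw [Subgroup.index_top, sq_le_one_iff₀ (Nat.zero_le _)] at hindex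
    exact hindex.antisymm Fintype.card_pos

theorem linearTwist (hρ : IsAbsolutelyIrreducible ρ) (χ : G →* Kˣ) :
    IsAbsolutelyIrreducible (linearTwist ρ χ) where
  nonempty := hρ.nonempty
  span_range_eq_top := by
    rw [eq_top_iff, ← hρ.span_range_eq_top, Submodule.span_le]
    rintro _ ⟨g, rfl⟩
    have hg : ρ g = (χ g)⁻¹ • _root_.linearTwist ρ χ g := (inv_smul_smul (χ g) (ρ g)).symm
    rw [hg]
    exact Submodule.smul_mem _ ((χ g)⁻¹ : Kˣ).1 (Submodule.subset_span ⟨g, rfl⟩)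

end IsAbsolutelyIrreducible

end MatrixRepresentations

section TracePowers

open Polynomial

variable {K n : Type*} [Field K] [IsAlgClosed K] [Fintype n] [DecidableEq n]

theorem trace_pow_eq_sum_finrank_eigenspace {V : Type*} [AddCommGroup V] [Module K V]
    [FiniteDimensional K V] {f : Module.End K V} (hf : f.IsSemisimple)
    (hfin : {z | f.eigenspace z ≠ ⊥}.Finite) (k : ℕ) :
    LinearMap.trace K V (f ^ k) =
      ∑ z ∈ hfin.toFinset, (Module.finrank K (f.eigenspace z) : K) * z ^ k := by
  classical
  have hinternal : DirectSum.IsInternal f.eigenspace :=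
    DirectSum.isInternal_submodule_of_iSupIndep_of_iSup_eq_top f.eigenspaces_iSupIndep
      hf.iSup_eigenspace_eq_top
  have hpow (z : K) (v : f.eigenspace z) : (f ^ k) v = z ^ k • (v : V) := by
    obtain hv | hv := eq_or_ne (v : V) 0
    · rw [hv, map_zero, smul_zero]
    · exact Module.End.HasEigenvector.pow_apply ⟨v.2, hv⟩ k
  have hmaps (z : K) : Set.MapsTo (f ^ k) (f.eigenspace z) (f.eigenspace z) := fun v hv ↦ by
    rw [SetLike.mem_coe, hpow z ⟨v, hv⟩]
    exact Submodule.smul_mem _ _ hv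
  rw [LinearMap.trace_eq_sum_trace_restrict' hinternal hfin hmaps]
  refine Finset.sum_congr rfl fun z _ ↦ ?_
  have hscalar : (f ^ k).restrict (hmaps z) = z ^ k • LinearMap.id :=
    LinearMap.ext fun v ↦ Subtype.ext (hpow z v)
  rw [hscalar, map_smul, LinearMap.trace_id, smul_eq_mul, mul_comm]

theorem trace_pow_eq_sum_nthRoots {A : Matrix n n K} {e : ℕ} (he : (e : K) ≠ 0) (hA : A ^ e = 1)
    (k : ℕ) : (A ^ k).trace = ∑ z ∈ nthRootsFinset e (1 : K),
      (Module.finrank K (Module.End.eigenspace (toLin' A) z) : K) * z ^ k := by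
  have he0 : 0 < e := Nat.pos_of_ne_zero fun h ↦ he (by simp [h])
  set f : Module.End K (n → K) := toLin' A
  have hpow (m : ℕ) : f ^ m = toLin' (A ^ m) := (toLin'_pow A m).symm
  have hfe : f ^ e = 1 := by rw [hpow, hA, toLin'_one]; rfl
  have hss : f.IsSemisimple :=
    Module.End.isSemisimple_of_squarefree_aeval_eq_zero
      (separable_X_pow_sub_C (1 : K) he one_ne_zero).squarefree (by simp [hfe])
  have hfin : {z | f.eigenspace z ≠ ⊥}.Finite :=
    WellFoundedGT.finite_ne_bot_of_iSupIndep f.eigenspaces_iSupIndep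
  rw [← trace_toLin'_eq, ← hpow, trace_pow_eq_sum_finrank_eigenspace hss hfin]
  refine Finset.sum_subset (fun z hz ↦ ?_) fun z _ hz ↦ ?_
  · obtain ⟨v, hv⟩ := Module.End.HasEigenvalue.exists_hasEigenvector (hfin.mem_toFinset.1 hz)
    have hroot : z ^ e • v = (1 : K) • v := by
      rw [← hv.pow_apply, hfe, Module.End.one_apply, one_smul]
    exact (mem_nthRootsFinset he0 _).2 (smul_left_injective K hv.2 hroot)
  · have hbot : f.eigenspace z = ⊥ := by simpa using hz
    rw [hbot, finrank_bot, Nat.cast_zero, zero_mul]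

theorem isIntegral_trace_of_pow_eq_one {A : Matrix n n K} {e : ℕ} (he : (e : K) ≠ 0)
    (hA : A ^ e = 1) : IsIntegral ℤ A.trace := by
  have he0 : 0 < e := Nat.pos_of_ne_zero fun h ↦ he (by simp [h])
  rw [← pow_one A, trace_pow_eq_sum_nthRoots he hA]
  refine IsIntegral.sum _ fun z hz ↦ ?_
  have hz : z ^ e = 1 := (mem_nthRootsFinset he0 _).1 hz
  exact (isIntegral_natCast _).mul ((IsIntegral.of_pow he0 (hz ▸ isIntegral_one)).pow 1)

end TracePowers

section GaloisConjugation

variable {G n : Type*} [Group G] [Fintype n] [DecidableEq n]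

theorem exists_coprime_forall_apply_eq_pow {n : ℕ} [NeZero n]
    (α : cyclotomicSubfield n ≃ₐ[ℚ] cyclotomicSubfield n) :
    ∃ k : ℕ, k.Coprime n ∧ ∀ x : cyclotomicSubfield n, x ^ n = 1 → α x = x ^ k := by
  obtain ⟨ζ, hζ⟩ : ∃ ζ : cyclotomicSubfield n, IsPrimitiveRoot ζ n := by
    have hζ := Complex.isPrimitiveRoot_exp n (NeZero.ne n)
    exact ⟨⟨_, IntermediateField.subset_adjoin _ _ hζ.pow_eq_one⟩,
      IsPrimitiveRoot.coe_submonoidClass_iff.1 hζ⟩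
  refine ⟨(hζ.autToPow ℚ α : ZMod n).val, ZMod.val_coe_unit_coprime _, fun x hx ↦ ?_⟩
  obtain ⟨i, -, rfl⟩ := hζ.eq_pow_of_pow_eq_one hx
  rw [map_pow, ← hζ.autToPow_spec ℚ α, pow_right_comm]

theorem GaloisConjugate.exists_coprime_forall_eq_trace_pow {ρ : G →* Matrix n n ℂ} {ψ : G → ℂ}
    (h : GaloisConjugate (fun g ↦ (ρ g).trace) ψ) :
    ∃ k : ℕ, k.Coprime (Nat.card G) ∧ ∀ g, ψ g = (ρ (g ^ k)).trace := by
  obtain ⟨N, hN, hdvd, α, hα⟩ := h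
  have : NeZero N := ⟨hN.ne'⟩
  obtain ⟨k, hk, hαk⟩ := exists_coprime_forall_apply_eq_pow α
  refine ⟨k, hk.coprime_dvd_right hdvd, fun g ↦ ?_⟩
  have hroot {z : ℂ} (hz : z ∈ Polynomial.nthRootsFinset N (1 : ℂ)) : z ^ N = 1 :=
    (Polynomial.mem_nthRootsFinset hN _).1 hz
  let root (z : Polynomial.nthRootsFinset N (1 : ℂ)) : cyclotomicSubfield N :=
    ⟨z, IntermediateField.subset_adjoin _ _ (hroot z.2)⟩
  have hpow : ρ g ^ N = 1 := by
    obtain ⟨m, rfl⟩ := hdvd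
    rw [← map_pow, pow_mul, pow_card_eq_one', one_pow, map_one]
  have htrace (j : ℕ) : (ρ (g ^ j)).trace = ∑ z ∈ (Polynomial.nthRootsFinset N (1 : ℂ)).attach,
      (Module.finrank ℂ (Module.End.eigenspace (toLin' (ρ g)) z) : ℂ) * (root z : ℂ) ^ j := by
    rw [map_pow, trace_pow_eq_sum_nthRoots (NeZero.ne _) hpow, ← Finset.sum_attach]
  obtain ⟨x, hx, hαx⟩ := hα g
  have hxsum : x = ∑ z ∈ (Polynomial.nthRootsFinset N (1 : ℂ)).attach,
      (Module.finrank ℂ (Module.End.eigenspace (toLin' (ρ g)) z) : cyclotomicSubfield N) *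
        root z := by
    apply Subtype.ext
    have htrace1 := htrace 1
    simp only [pow_one] at htrace1
    refine (hx.trans htrace1).trans ?_
    push_cast
    rfl
  rw [← hαx, hxsum, map_sum, htrace]
  push_cast
  refine Finset.sum_congr rfl fun z _ ↦ ?_
  rw [map_mul, map_natCast, hαk _ (Subtype.ext (hroot z.2))]
  push_cast
  rfl

end GaloisConjugation

section IntegralScalars

theorem natCast_dvd_of_isIntegral {K : Type*} [Field K] [CharZero K] {a b : ℕ} {ω : K}
    (hω : IsIntegral ℤ ω) (h : ω * a = b) : a ∣ b := by
  obtain rfl | ha := eq_or_ne a 0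
  · rw [Nat.cast_zero, mul_zero, eq_comm, Nat.cast_eq_zero] at h
    exact h ▸ dvd_rfl
  have ha' : (a : K) ≠ 0 := Nat.cast_ne_zero.2 ha
  obtain ⟨m, rfl⟩ := hω.exists_int_iff_exists_rat.1 ⟨b / a, by
    rw [eq_div_of_mul_eq ha' h, Rat.cast_div, Rat.cast_natCast, Rat.cast_natCast]⟩
  exact Int.natCast_dvd_natCast.1 ⟨m, by rw [mul_comm]; exact_mod_cast h.symm⟩

variable {K G n : Type*} [Field K] [Group G] [Fintype n] [DecidableEq n] {ρ : G →* Matrix n n K}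

theorem IsAbsolutelyIrreducible.exists_isIntegral_sum_smul_eq [Fintype G]
    (hρ : IsAbsolutelyIrreducible ρ) {c : G → K} (hc : ∀ g h, c (h * g * h⁻¹) = c g)
    (hint : ∀ g, IsIntegral ℤ (c g)) :
    ∃ ω : K, IsIntegral ℤ ω ∧ ∑ g, c g • ρ g = ω • 1 := by
  obtain ⟨ω, hω⟩ := hρ.exists_eq_smul_one_of_commute (A := ∑ g, c g • ρ g) fun h ↦ by
    rw [commute_iff_eq, Finset.mul_sum, Finset.sum_mul]
    refine Fintype.sum_equiv (MulAut.conj h).toEquiv _ _ fun g ↦ ?_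
    rw [MulEquiv.toEquiv_eq_coe, MulEquiv.coe_toEquiv, MulAut.conj_apply, hc, mul_smul_comm,
      smul_mul_assoc, ← map_mul, ← map_mul, inv_mul_cancel_right]
  refine ⟨ω, ?_, hω⟩
  let R := integralClosure ℤ K
  let a : MonoidAlgebra R G := ∑ g, MonoidAlgebra.single g ⟨c g, hint g⟩
  have ha : MonoidAlgebra.lift R _ G ρ a = algebraMap K (Matrix n n K) ω := by
    rw [Algebra.algebraMap_eq_smul_one, ← hω, map_sum]
    exact Finset.sum_congr rfl fun g _ ↦ MonoidAlgebra.lift_single ..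
  have := hρ.nonempty
  have hωR : IsIntegral R (algebraMap K (Matrix n n K) ω) :=
    ha ▸ (IsIntegral.of_finite R a).map (MonoidAlgebra.lift R (Matrix n n K) G ρ)
  exact isIntegral_trans ω
    ((isIntegral_algebraMap_iff (algebraMap K (Matrix n n K)).injective).1 hωR)

end IntegralScalars

section Orthogonality

variable {K G n : Type*} [Field K] [IsAlgClosed K] [CharZero K] [Group G] [Finite G]
  [Fintype n] [DecidableEq n] {ρ : G →* Matrix n n K}

theorem IsAbsolutelyIrreducible.sum_trace_mul_trace_inv [Fintype G]
    (hρ : IsAbsolutelyIrreducible ρ) :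
    ∑ g, (ρ g).trace * (ρ g⁻¹).trace = Nat.card G := by
  have hcard : (Nat.card G : K) ≠ 0 := Nat.cast_ne_zero.2 Nat.card_pos.ne'
  have := invertibleOfNonzero hcard
  have := hρ.isIrreducible_toRepresentation
  have horth := Representation.char_orthonormal (toRepresentation ρ) (toRepresentation ρ)
  rw [if_pos ⟨.refl _⟩, inv_mul_eq_one₀ hcard] at horth
  simp only [horth, character_toRepresentation]

namespace IsAbsolutelyIrreducible

theorem card_dvd_card (hρ : IsAbsolutelyIrreducible ρ) : Fintype.card n ∣ Nat.card G := by
  have := Fintype.ofFinite G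
  have hint (g : G) : IsIntegral ℤ (ρ g).trace :=
    isIntegral_trace_of_pow_eq_one (Nat.cast_ne_zero.2 Nat.card_pos.ne')
      (by rw [← map_pow, pow_card_eq_one', map_one])
  obtain ⟨ω, hω, hsum⟩ := hρ.exists_isIntegral_sum_smul_eq (c := fun g ↦ (ρ g⁻¹).trace)
    (fun g h ↦ by rw [conj_inv, trace_map_conj]) fun g ↦ hint g⁻¹
  refine natCast_dvd_of_isIntegral hω ?_
  calc ω * Fintype.card n = (ω • (1 : Matrix n n K)).trace := by
        rw [trace_smul, trace_one, smul_eq_mul]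
    _ = ∑ g, (ρ g).trace * (ρ g⁻¹).trace := by
        rw [← hsum, trace_sum]
        exact Finset.sum_congr rfl fun g _ ↦ by rw [trace_smul, smul_eq_mul, mul_comm]
    _ = Nat.card G := hρ.sum_trace_mul_trace_inv

theorem exists_card_eq_pow {p : ℕ} [hp : Fact p.Prime] (hρ : IsAbsolutelyIrreducible ρ)
    (hG : IsPGroup p G) : ∃ a, Fintype.card n = p ^ a := by
  obtain ⟨s, hs⟩ := IsPGroup.iff_card.1 hG
  obtain ⟨a, -, ha⟩ := (Nat.dvd_prime_pow hp.out).1 (hs ▸ hρ.card_dvd_card)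
  exact ⟨a, ha⟩

end IsAbsolutelyIrreducible

end Orthogonality

theorem IsAbsolutelyIrreducible.isIrrChar_trace {G : Type*} [Group G] {d : ℕ}
    {ρ : G →* Matrix (Fin d) (Fin d) ℂ} (hρ : IsAbsolutelyIrreducible ρ) :
    IsIrrChar fun g ↦ (ρ g).trace :=
  ⟨d, toRepresentation ρ, hρ.isIrreducible_toRepresentation,
    funext (character_toRepresentation ρ)⟩

section CentralCommutator

variable {K G n : Type*} [Field K] [Group G] [Fintype n] [DecidableEq n] {ρ : G →* Matrix n n K}

namespace IsAbsolutelyIrreducible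

theorem trace_mul_trace_inv_of_mem_center (hρ : IsAbsolutelyIrreducible ρ) {z : G}
    (hz : z ∈ Subgroup.center G) : (ρ z).trace * (ρ z⁻¹).trace = (Fintype.card n : K) ^ 2 := by
  obtain ⟨a, ha⟩ := hρ.exists_eq_smul_one_of_mem_center hz
  have hinv : a • ρ z⁻¹ = 1 := by
    rw [← smul_one_mul, ← ha, ← map_mul, mul_inv_cancel, map_one]
  calc (ρ z).trace * (ρ z⁻¹).trace = Fintype.card n * (a • ρ z⁻¹).trace := by
        rw [ha, trace_smul, trace_smul, trace_one, smul_eq_mul, smul_eq_mul]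
        ring
    _ = (Fintype.card n : K) ^ 2 := by rw [hinv, trace_one, sq]

theorem trace_eq_zero_of_notMem_center (hρ : IsAbsolutelyIrreducible ρ)
    (hinj : Function.Injective ρ) (hG : commutator G ≤ Subgroup.center G) {x : G}
    (hx : x ∉ Subgroup.center G) : (ρ x).trace = 0 := by
  obtain ⟨y, hy⟩ : ∃ y, y * x ≠ x * y := by simpa [Subgroup.mem_center_iff] using hx
  obtain ⟨ζ, hζ⟩ :=
    hρ.exists_eq_smul_one_of_mem_center (hG (commutatorElement_mem_commutator y x))
  have hζ1 : ζ ≠ 1 := by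
    rintro rfl
    rw [one_smul, ← map_one ρ, hinj.eq_iff, commutatorElement_eq_one_iff_mul_comm] at hζ
    exact hy hζ
  have htrace : ζ * (ρ x).trace = (ρ x).trace := by
    rw [← smul_eq_mul, ← trace_smul, ← smul_one_mul, ← hζ, ← map_mul,
      ← conj_eq_commutatorElement_mul, MulAut.conj_apply, trace_map_conj]
  exact (mul_left_eq_self₀.1 htrace).resolve_left hζ1

theorem index_center_eq_sq_card [IsAlgClosed K] [CharZero K] [Finite G]
    (hρ : IsAbsolutelyIrreducible ρ) (hinj : Function.Injective ρ)
    (hG : commutator G ≤ Subgroup.center G) :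
    (Subgroup.center G).index = Fintype.card n ^ 2 := by
  classical
  have := Fintype.ofFinite G
  have hterm (x : G) : (ρ x).trace * (ρ x⁻¹).trace =
      if x ∈ Subgroup.center G then (Fintype.card n : K) ^ 2 else 0 := by
    split_ifs with hx
    · exact hρ.trace_mul_trace_inv_of_mem_center hx
    · rw [hρ.trace_eq_zero_of_notMem_center hinj hG hx, zero_mul]
  have hsum := hρ.sum_trace_mul_trace_inv
  simp only [hterm] at hsum
  rw [← Finset.sum_filter, Finset.sum_const, nsmul_eq_mul, ← Fintype.card_subtype,
    ← Nat.card_eq_fintype_card, ← (Subgroup.center G).card_mul_index] at hsum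
  exact (Nat.eq_of_mul_eq_mul_left Nat.card_pos (by exact_mod_cast hsum)).symm

theorem isCyclic_center [Finite G] (hρ : IsAbsolutelyIrreducible ρ)
    (hinj : Function.Injective ρ) : IsCyclic (Subgroup.center G) := by
  obtain ⟨i⟩ := hρ.nonempty
  have hentry (z : Subgroup.center G) : ρ z = ρ z i i • 1 := by
    obtain ⟨c, hc⟩ := hρ.exists_eq_smul_one_of_mem_center z.2
    rw [hc, Matrix.smul_apply, one_apply_eq, smul_eq_mul, mul_one]
  let f : Subgroup.center G →* K :=
    { toFun z := ρ z i i
      map_one' := by simp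
      map_mul' a b := calc
        ρ (a * b) i i = (ρ a i i • 1 * ρ b : Matrix n n K) i i := by rw [← hentry a, ← map_mul]
        _ = ρ a i i * ρ b i i := by rw [smul_one_mul, Matrix.smul_apply, smul_eq_mul] }
  refine isCyclic_of_injective_ringHom f fun a b hab ↦ Subtype.ext (hinj ?_)
  rw [hentry a, hentry b]
  exact congrArg (· • 1) hab

end IsAbsolutelyIrreducible

end CentralCommutator

section Wedderburn

theorem span_range_monoidAlgebra_of_eq_top (K G : Type*) [Semiring K] [MulOneClass G] :
    Submodule.span K (Set.range (MonoidAlgebra.of K G)) = ⊤ :=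
  (MonoidAlgebra.basis G K).span_eq

theorem span_range_comp_monoidAlgebra_of_eq_top {K G V : Type*} [CommSemiring K] [MulOneClass G]
    [AddCommMonoid V] [Module K V] {f : MonoidAlgebra K G →ₗ[K] V} (hf : Function.Surjective f) :
    Submodule.span K (Set.range (f ∘ MonoidAlgebra.of K G)) = ⊤ := by
  rw [Set.range_comp, Submodule.span_image, span_range_monoidAlgebra_of_eq_top, Submodule.map_top,
    LinearMap.range_eq_top.2 hf]

variable {K G ι : Type*} [Field K] [Group G] {n : ι → Type*} [∀ i, Fintype (n i)]
  [∀ i, DecidableEq (n i)]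

theorem sum_sq_card_eq_card [Fintype ι]
    (e : MonoidAlgebra K G ≃ₐ[K] Π i, Matrix (n i) (n i) K) :
    ∑ i, Fintype.card (n i) ^ 2 = Nat.card G := by
  have hfinrank := e.toLinearEquiv.finrank_eq
  rw [Module.finrank_eq_nat_card_basis (MonoidAlgebra.basis G K),
    Module.finrank_pi_fintype] at hfinrank
  simp only [hfinrank, Module.finrank_matrix, Module.finrank_self, mul_one, sq]

variable (e : MonoidAlgebra K G ≃ₐ[K] Π i, Matrix (n i) (n i) K)

/-- The matrix representation of `G` on the `i`-th factor of a Wedderburn decomposition `e` of its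
group algebra. -/
noncomputable def wedderburnComponent (i : ι) : G →* Matrix (n i) (n i) K :=
  (MonoidAlgebra.lift K _ G).symm ((Pi.evalAlgHom K _ i).comp e.toAlgHom)

theorem isAbsolutelyIrreducible_wedderburnComponent (i : ι) [Nonempty (n i)] :
    IsAbsolutelyIrreducible (wedderburnComponent e i) where
  nonempty := inferInstance
  span_range_eq_top := by
    let f : MonoidAlgebra K G →ₗ[K] Matrix (n i) (n i) K := LinearMap.proj i ∘ₗ e.toLinearMap
    have hf : Function.Surjective f := (Function.surjective_eval i).comp e.surjective
    have hcomp : ⇑(wedderburnComponent e i) = f ∘ MonoidAlgebra.of K G := rfl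
    rw [hcomp, span_range_comp_monoidAlgebra_of_eq_top hf]

theorem eq_of_trace_wedderburnComponent_eq {i j : ι} [Nonempty (n i)]
    (h : ∀ g, (wedderburnComponent e i g).trace = (wedderburnComponent e j g).trace) : i = j := by
  classical
  by_contra hij
  have htrace : traceLinearMap (n i) K K ∘ₗ LinearMap.proj i ∘ₗ e.toLinearMap =
      traceLinearMap (n j) K K ∘ₗ LinearMap.proj j ∘ₗ e.toLinearMap :=
    LinearMap.ext_on_range (span_range_monoidAlgebra_of_eq_top K G) h
  obtain ⟨a⟩ : Nonempty (n i) := inferInstance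
  have hsingle := LinearMap.congr_fun htrace (e.symm (Pi.single i (Matrix.single a a 1)))
  simp [Pi.single_eq_of_ne' hij] at hsingle

theorem sum_sq_card_le_index {N : Subgroup G} [N.FiniteIndex] {S : Finset ι}
    (hS : ∀ i ∈ S, N ≤ (wedderburnComponent e i).ker) :
    ∑ i ∈ S, Fintype.card (n i) ^ 2 ≤ N.index := by
  classical
  let f : MonoidAlgebra K G →ₗ[K] Π i : S, Matrix (n i) (n i) K :=
    (LinearMap.pi fun i : S ↦ LinearMap.proj (i : ι)) ∘ₗ e.toLinearMap
  have hf : Function.Surjective f := by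
    refine fun y ↦ ⟨e.symm fun i ↦ if h : i ∈ S then y ⟨i, h⟩ else 0, funext fun i ↦ ?_⟩
    simp [f]
  have hN (g : G) {x : G} (hx : x ∈ N) :
      f (MonoidAlgebra.of K G (g * x)) = f (MonoidAlgebra.of K G g) := by
    funext i
    change wedderburnComponent e i (g * x) = wedderburnComponent e i g
    rw [map_mul, MonoidHom.mem_ker.1 (hS i i.2 hx), mul_one]
  have hle := finrank_le_index_of_span_range_eq_top
    (span_range_comp_monoidAlgebra_of_eq_top hf) (N := N) fun g x hx ↦
      Submodule.mem_span_singleton.2 ⟨1, by rw [one_smul, Function.comp, Function.comp, hN g hx]⟩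
  rw [Module.finrank_pi_fintype] at hle
  simpa only [Module.finrank_matrix, Module.finrank_self, mul_one, ← sq,
    Finset.sum_coe_sort S fun i ↦ Fintype.card (n i) ^ 2] using hle

open Classical in
theorem card_sub_one_mul_index_le [Fintype ι] (N : Subgroup G) [N.FiniteIndex] :
    (Nat.card N - 1) * N.index ≤
      ∑ i with ¬N ≤ (wedderburnComponent e i).ker, Fintype.card (n i) ^ 2 := by
  rw [Nat.sub_mul, one_mul, tsub_le_iff_left, N.card_mul_index, ← sum_sq_card_eq_card e,
    ← Finset.sum_filter_add_sum_filter_not _ fun i ↦ N ≤ (wedderburnComponent e i).ker]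
  gcongr
  exact sum_sq_card_le_index e fun i hi ↦ (Finset.mem_filter.1 hi).2

theorem exists_isAbsolutelyIrreducible_of_commutator_ne_bot [IsAlgClosed K] [CharZero K] [Finite G]
    (hG : commutator G ≠ ⊥) :
    ∃ (d : ℕ) (ρ : G →* Matrix (Fin d) (Fin d) K), IsAbsolutelyIrreducible ρ ∧ d ≠ 1 := by
  obtain ⟨m, d, hd, ⟨e⟩⟩ :=
    IsSemisimpleRing.exists_algEquiv_pi_matrix_of_isAlgClosed K (MonoidAlgebra K G)
  have hirr (i : Fin m) := isAbsolutelyIrreducible_wedderburnComponent e i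
  by_contra! hlinear
  have hker (i : Fin m) : commutator G ≤ (wedderburnComponent e i).ker :=
    (hirr i).card_eq_one_iff.1 (by rw [Fintype.card_fin, hlinear _ _ (hirr i)])
  have hle := sum_sq_card_le_index e fun i (_ : i ∈ Finset.univ) ↦ hker i
  rw [sum_sq_card_eq_card e, ← (commutator G).card_mul_index] at hle
  refine hG (Subgroup.eq_bot_of_card_le _ (Nat.le_of_mul_le_mul_right ?_
    (Nat.pos_of_ne_zero (commutator G).index_ne_zero_of_finite)))
  rwa [one_mul]

end Wedderburn

/-- Any two irreducible complex representations of the same degree different from `1` have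
characters related by a power map `g ↦ g ^ k` with `k` prime to the group order. This is the form
of the `GC*` property that passes to quotients. The degrees are separate variables so that members
of an indexed family can be compared without rewriting matrix types. -/
def SameDegreePowerConjugate (G : Type*) [Group G] : Prop :=
  ∀ ⦃d e : ℕ⦄ ⦃ρ : G →* Matrix (Fin d) (Fin d) ℂ⦄ ⦃σ : G →* Matrix (Fin e) (Fin e) ℂ⦄,
    IsAbsolutelyIrreducible ρ → IsAbsolutelyIrreducible σ → d ≠ 1 → d = e →
      ∃ k : ℕ, k.Coprime (Nat.card G) ∧ ∀ g, (σ g).trace = (ρ (g ^ k)).trace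

theorem IsGCStar.sameDegreePowerConjugate {G : Type*} [Group G] (h : IsGCStar G) :
    SameDegreePowerConjugate G := by
  rintro d _ ρ σ hρ hσ hd rfl
  have hdeg (τ : G →* Matrix (Fin d) (Fin d) ℂ) : (τ 1).trace = d := by
    rw [map_one, trace_one, Fintype.card_fin]
  have hd' (τ : G →* Matrix (Fin d) (Fin d) ℂ) : (τ 1).trace ≠ 1 := by
    rwa [hdeg, Nat.cast_ne_one]
  exact (h _ _ hρ.isIrrChar_trace hσ.isIrrChar_trace (hd' ρ) (hd' σ)
    ((hdeg ρ).trans (hdeg σ).symm)).exists_coprime_forall_eq_trace_pow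

theorem exists_monoidHom_apply_ne_one_of_notMem_commutator {G : Type*} [Group G] [Finite G] {g : G}
    (hg : g ∉ commutator G) : ∃ χ : G →* ℂˣ, χ g ≠ 1 := by
  have hg' : Abelianization.of g ≠ 1 := by
    rwa [Ne, ← MonoidHom.mem_ker, Abelianization.ker_of]
  have : NeZero (Monoid.exponent (Abelianization G)) := ⟨Monoid.exponent_ne_zero_of_finite⟩
  obtain ⟨χ, hχ⟩ := CommGroup.exists_apply_ne_one_of_hasEnoughRootsOfUnity (Abelianization G) ℂ hg'
  exact ⟨χ.comp Abelianization.of, hχ⟩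

namespace SameDegreePowerConjugate

variable {G : Type*} [Group G]

theorem quotient (h : SameDegreePowerConjugate G) (N : Subgroup G) [N.Normal] :
    SameDegreePowerConjugate (G ⧸ N) := by
  intro d e ρ σ hρ hσ hd hde
  have hN := QuotientGroup.mk'_surjective N
  obtain ⟨k, hk, htrace⟩ := h (hρ.comp_surjective hN) (hσ.comp_surjective hN) hd hde
  refine ⟨k, hk.coprime_dvd_right N.card_quotient_dvd_card, hN.forall.2 fun g ↦ ?_⟩
  rw [← map_pow]
  exact htrace g

theorem eq_one_of_eq_smul_one (h : SameDegreePowerConjugate G) {d e : ℕ}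
    {ρ : G →* Matrix (Fin d) (Fin d) ℂ} {σ : G →* Matrix (Fin e) (Fin e) ℂ}
    (hρ : IsAbsolutelyIrreducible ρ) (hσ : IsAbsolutelyIrreducible σ) (hd : d ≠ 1) (hde : d = e)
    {x : G} (hx : x ∈ ρ.ker) {c : ℂ} (hc : σ x = c • 1) : c = 1 := by
  obtain ⟨k, -, hk⟩ := h hρ hσ hd hde
  have he : (e : ℂ) ≠ 0 := Nat.cast_ne_zero.2 (Fin.pos_iff_nonempty.2 hσ.nonempty).ne'
  have htrace : c * e = e := calc
    c * e = (σ x).trace := by rw [hc, trace_smul, trace_one, Fintype.card_fin, smul_eq_mul]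
      _ = e := by rw [hk, MonoidHom.mem_ker.1 (pow_mem hx k), trace_one, Fintype.card_fin, hde]
  exact (mul_eq_right₀ he).1 htrace

theorem le_ker_of_comp_mk' (h : SameDegreePowerConjugate G) {M : Subgroup G} [M.Normal]
    (hM : M ≤ Subgroup.center G) {d e : ℕ} {ρ : G ⧸ M →* Matrix (Fin d) (Fin d) ℂ}
    {σ : G →* Matrix (Fin e) (Fin e) ℂ} (hρ : IsAbsolutelyIrreducible ρ)
    (hσ : IsAbsolutelyIrreducible σ) (hd : d ≠ 1) (hde : d = e) : M ≤ σ.ker := by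
  intro x hx
  have hxρ : x ∈ (ρ.comp (QuotientGroup.mk' M)).ker := by
    rw [MonoidHom.mem_ker, MonoidHom.comp_apply, QuotientGroup.mk'_apply,
      (QuotientGroup.eq_one_iff x).2 hx, map_one]
  obtain ⟨c, hc⟩ := hσ.exists_eq_smul_one_of_mem_center (hM hx)
  have hc1 : c = 1 := h.eq_one_of_eq_smul_one
    (hρ.comp_surjective (QuotientGroup.mk'_surjective M)) hσ hd hde hxρ hc
  rw [MonoidHom.mem_ker, hc, hc1, one_smul]

theorem le_commutator_of_not_commutator_le [Finite G] (h : SameDegreePowerConjugate G)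
    {N : Subgroup G} [N.Normal] (hN : ¬commutator G ≤ N) : N ≤ commutator G := by
  intro x hx
  by_contra hxG
  obtain ⟨χ, hχ⟩ := exists_monoidHom_apply_ne_one_of_notMem_commutator hxG
  obtain ⟨d, ρ, hρ, hd⟩ := exists_isAbsolutelyIrreducible_of_commutator_ne_bot (K := ℂ)
    (mt commutator_quotient_eq_bot_iff.1 hN)
  have hτ := hρ.comp_surjective (QuotientGroup.mk'_surjective N)
  have hxτ : ρ.comp (QuotientGroup.mk' N) x = 1 := by
    rw [MonoidHom.comp_apply, QuotientGroup.mk'_apply, (QuotientGroup.eq_one_iff x).2 hx, map_one]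
  refine hχ (Units.ext (h.eq_one_of_eq_smul_one hτ (hτ.linearTwist χ) hd rfl hxτ ?_))
  exact congrArg ((χ x : ℂ) • ·) hxτ

theorem card_le_totient_exponent [Finite G] (h : SameDegreePowerConjugate G) {ι : Type*}
    {d : ι → ℕ} {ρ : ∀ i, G →* Matrix (Fin (d i)) (Fin (d i)) ℂ}
    (hρ : ∀ i, IsAbsolutelyIrreducible (ρ i))
    (hinj : ∀ i j, (∀ g, (ρ i g).trace = (ρ j g).trace) → i = j) {c : ℕ} (hc : c ≠ 1)
    {S : Finset ι} (hS : ∀ i ∈ S, d i = c) : S.card ≤ (Monoid.exponent G).totient := by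
  obtain rfl | ⟨j, hj⟩ := S.eq_empty_or_nonempty
  · exact Nat.zero_le _
  have hconj (i) (hi : i ∈ S) := h (hρ j) (hρ i) (hS j hj ▸ hc) ((hS j hj).trans (hS i hi).symm)
  choose! k hk htrace using hconj
  have hpos : 0 < Monoid.exponent G := Nat.pos_of_ne_zero Monoid.exponent_ne_zero_of_finite
  refine Finset.card_le_card_of_injOn (fun i ↦ k i % Monoid.exponent G) (fun i hi ↦ ?_)
    fun i hi i' hi' hii' ↦ hinj i i' fun g ↦ ?_
  · refine Finset.mem_coe.2 (Finset.mem_filter.2 ⟨Finset.mem_range.2 (Nat.mod_lt _ hpos), ?_⟩)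
    rw [Nat.coprime_comm, Nat.Coprime, ← Nat.gcd_rec, Nat.gcd_comm]
    exact (hk i hi).coprime_dvd_right Group.exponent_dvd_nat_card
  · rw [htrace i hi, htrace i' hi', Monoid.pow_eq_mod_exponent (n := k i),
      Monoid.pow_eq_mod_exponent (n := k i')]
    exact congrArg (fun m ↦ (ρ j (g ^ m)).trace) hii'

section CommutatorOfPrimeOrder

variable [Finite G]

theorem injective_of_card_commutator_prime (h : SameDegreePowerConjugate G)
    (hG : (Nat.card (commutator G)).Prime) {d : ℕ} {ρ : G →* Matrix (Fin d) (Fin d) ℂ}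
    (hρ : IsAbsolutelyIrreducible ρ) (hd : d ≠ 1) : Function.Injective ρ := by
  have hker : ¬commutator G ≤ ρ.ker := fun hle ↦
    hd (by rw [← hρ.card_eq_one_iff.2 hle, Fintype.card_fin])
  have hle : ρ.ker ≤ commutator G := h.le_commutator_of_not_commutator_le hker
  refine (MonoidHom.ker_eq_bot_iff ρ).1 (Subgroup.eq_bot_of_card_le _ ?_)
  refine ((hG.eq_one_or_self_of_dvd _ (Subgroup.card_dvd_of_le hle)).resolve_right ?_).le
  exact fun hcard ↦ hker (Subgroup.eq_of_le_of_card_ge hle hcard.ge).ge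

theorem exists_injective_of_card_commutator_prime (h : SameDegreePowerConjugate G)
    (hG : (Nat.card (commutator G)).Prime) :
    ∃ (d : ℕ) (ρ : G →* Matrix (Fin d) (Fin d) ℂ),
      IsAbsolutelyIrreducible ρ ∧ d ≠ 1 ∧ Function.Injective ρ := by
  obtain ⟨d, ρ, hρ, hd⟩ := exists_isAbsolutelyIrreducible_of_commutator_ne_bot (K := ℂ)
    fun hbot ↦ hG.ne_one (by rw [hbot, Subgroup.card_bot])
  exact ⟨d, ρ, hρ, hd, h.injective_of_card_commutator_prime hG hρ hd⟩

theorem isCyclic_center_of_card_commutator_prime (h : SameDegreePowerConjugate G)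
    (hG : (Nat.card (commutator G)).Prime) : IsCyclic (Subgroup.center G) := by
  obtain ⟨d, ρ, hρ, -, hinj⟩ := h.exists_injective_of_card_commutator_prime hG
  exact hρ.isCyclic_center hinj

end CommutatorOfPrimeOrder

end SameDegreePowerConjugate

section PrimePowerSums

theorem mul_sum_range_pow_lt {p : ℕ} (hp : 2 ≤ p) (n : ℕ) :
    p * ∑ a ∈ Finset.range n, (p ^ a) ^ 2 < (p ^ n) ^ 2 := by
  induction n with
  | zero => simp
  | succ n ih =>
    rw [Finset.sum_range_succ, mul_add, pow_succ p n, mul_pow]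
    have : (p ^ n) ^ 2 * (p + 1) ≤ (p ^ n) ^ 2 * p ^ 2 := Nat.mul_le_mul_left _ (by nlinarith)
    linarith

theorem mul_sum_sq_lt {ι : Type*} {T : Finset ι} {d : ι → ℕ} {p n B : ℕ} (hp : 2 ≤ p) (hB : 0 < B)
    (hd : ∀ i ∈ T, ∃ a < n, d i = p ^ a) (hfiber : ∀ i ∈ T, #{j ∈ T | d j = d i} ≤ B) :
    p * ∑ i ∈ T, d i ^ 2 < B * (p ^ n) ^ 2 := by
  have himage : T.image d ⊆ (Finset.range n).image (p ^ ·) := by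
    refine Finset.image_subset_iff.2 fun i hi ↦ ?_
    obtain ⟨a, ha, hda⟩ := hd i hi
    exact Finset.mem_image.2 ⟨a, Finset.mem_range.2 ha, hda.symm⟩
  have hsum : ∑ i ∈ T, d i ^ 2 ≤ B * ∑ a ∈ Finset.range n, (p ^ a) ^ 2 := calc
    ∑ i ∈ T, d i ^ 2 = ∑ c ∈ T.image d, #{i ∈ T | d i = c} * c ^ 2 := by
      rw [Finset.sum_comp (· ^ 2) d]
      simp only [smul_eq_mul]
    _ ≤ ∑ c ∈ T.image d, B * c ^ 2 := by
      refine Finset.sum_le_sum fun c hc ↦ Nat.mul_le_mul_right _ ?_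
      obtain ⟨i, hi, rfl⟩ := Finset.mem_image.1 hc
      exact hfiber i hi
    _ ≤ ∑ c ∈ (Finset.range n).image (p ^ ·), B * c ^ 2 := Finset.sum_le_sum_of_subset himage
    _ = B * ∑ a ∈ Finset.range n, (p ^ a) ^ 2 := by
      rw [Finset.sum_image (Nat.pow_right_injective hp).injOn, Finset.mul_sum]
  calc p * ∑ i ∈ T, d i ^ 2 ≤ B * (p * ∑ a ∈ Finset.range n, (p ^ a) ^ 2) := by
        rw [mul_left_comm]
        exact Nat.mul_le_mul_left p hsum
    _ < B * (p ^ n) ^ 2 := Nat.mul_lt_mul_of_pos_left (mul_sum_range_pow_lt hp n) hB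

end PrimePowerSums

section CentralQuotientOfPGroup

variable {G : Type*} [Group G] [Finite G] {p : ℕ} [hp : Fact p.Prime] {M : Subgroup G} [M.Normal]

theorem totient_exponent_le_of_card_commutator_quotient (hG : IsPGroup p G) (hM : Nat.card M = p)
    (hcard : Nat.card (commutator (G ⧸ M)) = p) :
    (Monoid.exponent G).totient ≤ Nat.card (Subgroup.center (G ⧸ M)) * p * (p - 1) := by
  have hGM := hG.to_quotient M
  have := hGM.isNilpotent
  obtain ⟨t, ht⟩ := IsPGroup.iff_card.1 (hGM.to_subgroup (Subgroup.center (G ⧸ M)))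
  have hdvd := exponent_dvd_of_commutator_quotient_le_center (M := M)
    (le_center_of_card_prime (hcard ▸ hp.out))
  rw [hcard, hM, ht, ← pow_succ, ← pow_succ'] at hdvd
  rw [ht, ← pow_succ, ← Nat.totient_prime_pow_succ hp.out]
  exact Nat.le_of_dvd (Nat.totient_pos.2 (pow_pos hp.out.pos _)) (Nat.totient_dvd_of_dvd hdvd)

namespace SameDegreePowerConjugate

theorem index_center_eq_sq (h : SameDegreePowerConjugate G) (hG : IsPGroup p G)
    (hcard : Nat.card (commutator G) = p) {d : ℕ} {ρ : G →* Matrix (Fin d) (Fin d) ℂ}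
    (hρ : IsAbsolutelyIrreducible ρ) (hd : d ≠ 1) : (Subgroup.center G).index = d ^ 2 := by
  have := hG.isNilpotent
  have hprime : (Nat.card (commutator G)).Prime := hcard ▸ hp.out
  rw [hρ.index_center_eq_sq_card (h.injective_of_card_commutator_prime hprime hρ hd)
    (le_center_of_card_prime hprime), Fintype.card_fin]

theorem exists_lt_eq_pow_of_not_le_ker (h : SameDegreePowerConjugate G) (hG : IsPGroup p G)
    (hM : Nat.card M = p) (hcard : Nat.card (commutator (G ⧸ M)) = p) {n : ℕ}
    {σ : G ⧸ M →* Matrix (Fin (p ^ n)) (Fin (p ^ n)) ℂ} (hσ : IsAbsolutelyIrreducible σ)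
    (hn : p ^ n ≠ 1) {d : ℕ} {ρ : G →* Matrix (Fin d) (Fin d) ℂ} (hρ : IsAbsolutelyIrreducible ρ)
    (hker : ¬M ≤ ρ.ker) : ∃ a < n, d = p ^ a := by
  have := hG.isNilpotent
  have hMZ : M ≤ Subgroup.center G := le_center_of_card_prime (hM ▸ hp.out)
  obtain ⟨a, ha⟩ := hρ.exists_card_eq_pow hG
  rw [Fintype.card_fin] at ha
  subst ha
  refine ⟨a, lt_of_le_of_ne ?_ ?_, rfl⟩
  · have hq := h.quotient M
    have := hq.isCyclic_center_of_card_commutator_prime (hcard ▸ hp.out)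
    have hle : (p ^ a) ^ 2 ≤ p * (p ^ n) ^ 2 := by
      calc (p ^ a) ^ 2 ≤ (Subgroup.center G).index := by
            simpa only [Fintype.card_fin] using hρ.sq_card_le_index_center
        _ ≤ p * (Subgroup.center (G ⧸ M)).index := hM ▸ index_center_le hMZ
        _ = p * (p ^ n) ^ 2 := by
            rw [hq.index_center_eq_sq (hG.to_quotient M) hcard hσ hn]
    rw [← pow_mul, ← pow_mul, ← pow_succ', Nat.pow_le_pow_iff_right hp.out.one_lt] at hle
    omega
  · rintro rfl
    exact hker (h.le_ker_of_comp_mk' hMZ hσ hρ hn rfl)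

theorem card_commutator_quotient_ne (h : SameDegreePowerConjugate G) (hG : IsPGroup p G)
    (hM : Nat.card M = p) (hMG : M ≤ commutator G) : Nat.card (commutator (G ⧸ M)) ≠ p := by
  classical
  intro hcard
  have hGM := hG.to_quotient M
  obtain ⟨d₀, σ, hσ, hd₀, -⟩ :=
    (h.quotient M).exists_injective_of_card_commutator_prime (hcard ▸ hp.out)
  obtain ⟨n, hn⟩ := hσ.exists_card_eq_pow hGM
  obtain rfl : d₀ = p ^ n := by rwa [Fintype.card_fin] at hn
  have hindex := (h.quotient M).index_center_eq_sq hGM hcard hσ hd₀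
  obtain ⟨m, d, _, ⟨e⟩⟩ :=
    IsSemisimpleRing.exists_algEquiv_pi_matrix_of_isAlgClosed ℂ (MonoidAlgebra ℂ G)
  have hirr (i : Fin m) := isAbsolutelyIrreducible_wedderburnComponent e i
  let T : Finset (Fin m) := {i | ¬M ≤ (wedderburnComponent e i).ker}
  have hker {i : Fin m} (hi : i ∈ T) : ¬M ≤ (wedderburnComponent e i).ker :=
    (Finset.mem_filter.1 hi).2
  have hnonlinear {i : Fin m} (hi : i ∈ T) : d i ≠ 1 := fun hdi ↦
    hker hi (hMG.trans ((hirr i).card_eq_one_iff.1 (by rwa [Fintype.card_fin])))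
  have hlt : p * ∑ i ∈ T, d i ^ 2 <
      Nat.card (Subgroup.center (G ⧸ M)) * p * (p - 1) * (p ^ n) ^ 2 := by
    refine mul_sum_sq_lt hp.out.two_le
      (Nat.mul_pos (Nat.mul_pos Nat.card_pos hp.out.pos) (Nat.sub_pos_of_lt hp.out.one_lt))
      (fun i hi ↦ h.exists_lt_eq_pow_of_not_le_ker hG hM hcard hσ hd₀ (hirr i) (hker hi))
      fun i hi ↦ (h.card_le_totient_exponent hirr (fun _ _ ↦ eq_of_trace_wedderburnComponent_eq e)
        (hnonlinear hi) fun j hj ↦ (Finset.mem_filter.1 hj).2).trans ?_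
    exact totient_exponent_le_of_card_commutator_quotient hG hM hcard
  have hge : (p - 1) * M.index ≤ ∑ i ∈ T, d i ^ 2 := by
    simpa only [hM, Fintype.card_fin] using card_sub_one_mul_index_le e M
  refine hlt.not_ge ?_
  calc Nat.card (Subgroup.center (G ⧸ M)) * p * (p - 1) * (p ^ n) ^ 2
      = p * ((p - 1) * M.index) := by
        rw [M.index_eq_card, ← (Subgroup.center (G ⧸ M)).card_mul_index, hindex]
        ring
    _ ≤ p * ∑ i ∈ T, d i ^ 2 := Nat.mul_le_mul_left p hge

end SameDegreePowerConjugate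

end CentralQuotientOfPGroup

theorem SameDegreePowerConjugate.card_commutator_eq {p : ℕ} [hp : Fact p.Prime] {G : Type*}
    [Group G] [Finite G] (h : SameDegreePowerConjugate G) (hG : IsPGroup p G)
    (hne : commutator G ≠ ⊥) : Nat.card (commutator G) = p := by
  induction hn : Nat.card G using Nat.strong_induction_on generalizing G with
  | _ n ih =>
    subst hn
    have : Nontrivial G := Subgroup.nontrivial_iff.1 ⟨_, _, hne⟩
    obtain ⟨x, hx, hxp⟩ := exists_mem_center_orderOf_eq hG
    have := normal_of_le_center (Subgroup.zpowers_le.2 hx)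
    have hM : Nat.card (Subgroup.zpowers x) = p := by rw [Nat.card_zpowers, hxp]
    by_cases hle : commutator G ≤ Subgroup.zpowers x
    · exact (hp.out.eq_one_or_self_of_dvd _ (hM ▸ Subgroup.card_dvd_of_le hle)).resolve_left
        fun hone ↦ hne (Subgroup.eq_bot_of_card_le _ hone.le)
    · refine absurd (ih _ ?_ (h.quotient _) (hG.to_quotient _)
          (mt commutator_quotient_eq_bot_iff.1 hle) rfl)
        (h.card_commutator_quotient_ne hG hM (h.le_commutator_of_not_commutator_le hle))
      rw [Subgroup.card_eq_card_quotient_mul_card_subgroup (Subgroup.zpowers x), hM]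
      exact lt_mul_of_one_lt_right Nat.card_pos hp.out.one_lt

theorem corollary3p2 {G : Type*} [Group G] [Finite G] (hnil : Group.IsNilpotent G)
    (hGC : IsGCStar G) :
    (∀ a b : G, a * b = b * a) ∨
      ∃ p : ℕ, p.Prime ∧ IsPGroup p G ∧ IsCyclic (Subgroup.center G) ∧
        (Nat.card (commutator G)).Prime := by
  refine or_iff_not_imp_left.2 fun hab ↦ ?_
  have hne : commutator G ≠ ⊥ := mt commutator_eq_bot_iff_forall_mul_comm.1 hab
  have h := hGC.sameDegreePowerConjugate
  obtain ⟨p, hp, hG⟩ := exists_isPGroup_of_forall_normal_comparable hne fun N _ ↦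
    or_iff_not_imp_left.2 h.le_commutator_of_not_commutator_le
  have : Fact p.Prime := ⟨hp⟩
  have hprime : (Nat.card (commutator G)).Prime := (h.card_commutator_eq hG hne).symm ▸ hp
  exact ⟨p, hp, hG, h.isCyclic_center_of_card_commutator_prime hprime, hprime⟩
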